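/- Fix $\alpha>0$. For every integer $N\ge 1$ let $\Lambda_N=\{1,\dots,N\}$ and let $M=M_N$ be a positive integer equal to $N^{1+\alpha}$ up to rounding, i.e. $|M_N-N^{1+\alpha}|<1$. Consider the Markov process $\omega(t)=(\eta(\cdot,t),n_-(t),n_+(t))$ on $\{0,1\}^{\Lambda_N}\times\{0,\dots,M\}\times\{0,\dots,M\}$ with generator $$\mathbf L f(\omega)=\tfrac12\sum_{x=1}^{N-1}[f(\omega^{x,x+1})-f(\omega)]+c_N(\omega)[f(\omega^N)-f(\omega)]+c_1(\omega)[f(\omega^1)-f(\omega)],$$ where $\omega^{x,x+1}$ is obtained from $\omega$ by exchanging $\eta(x)$ and $\eta(x+1)$, $$c_N(\omega)=\tfrac12\Big(1-\frac{n_+}{M}\Big)\eta(N)+\tfrac12\,\frac{n_+}{M}\,(1-\eta(N)),\qquad c_1(\omega)=\tfrac12\Big(1-\frac{n_-}{M}\Big)\eta(1)+\tfrac12\,\frac{n_-}{M}\,(1-\eta(1)),$$ $\omega^N$ is obtained from $\omega$ by replacing $(\eta(N),n_+)$ by $(0,n_++1)$ if $\eta(N)=1$ and by $(1,n_+-1)$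 if $\eta(N)=0$, and $\omega^1$ is obtained likewise from $(\eta(1),n_-)$. Its law and expectation are denoted by $\mathbf P^N$ and $\mathbf E^N$. Let $v_{0,-},v_{0,+}\in[0,1]$, and let $u_0:(0,1]\to[0,1]$ be continuous on $(0,1)$. Assume that at time $0$ $$\mathbf P^N\Big(\Big|\frac{n_\pm(0)}{M_N}-v_{0,\pm}\Big|\ge\delta\Big)\xrightarrow[N\to\infty]{}0\quad\text{for every }\delta>0,\qquad \mathbf E^N[\eta(x,0)]=u_0(x/N)\quad\text{for all } N\ge 1,\ x\in\Lambda_N .$$ Let $\mathcal E^N$ denote the expectation with respect to the symmetric simple exclusion process on $\{0,1\}^{\Lambda_N}$ with ideal reservoirs of fixed densities $v_{0,\pm}$, i.e. the Markov process with generator $$\mathcal L f(\eta)=\tfrac12\sum_{x=1}^{N-1}[f(\eta^{x,x+1})-f(\eta)]+\tfrac12\big[(1-v_{0,+})\eta(N)+v_{0,+}(1-\eta(N))\big][f(\eta^{N})-f(\eta)]+\tfrac12\big[(1-v_{0,-})\eta(1)+v_{0,-}(1-\eta(1))\big][f(\eta^{1})-f(\eta)],$$ where $\eta^{x,x+1}$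 is obtained from $\eta$ by exchanging $\eta(x)$ and $\eta(x+1)$, and $\eta^{x}$ by replacing $\eta(x)$ by $1-\eta(x)$, started from any initial distribution with $\mathcal E^N[\eta(x,0)]=u_0(x/N)$ for all $x\in\Lambda_N$. Then for every $\alpha'\in[0,\alpha)$ and every $T>0$, $$\lim_{N\to\infty}\ \sup_{x\in\Lambda_N}\ \sup_{t\in[0,T]}\Big|\mathbf E^N\big[\eta(x,N^{2+\alpha'}t)\big]-\mathcal E^N\big[\eta(x,N^{2+\alpha'}t)\big]\Big|=0 .$$ -/

import Mathlib

open MeasureTheory Filter Topology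
open scoped NNReal ENNReal

noncomputable section

/-! ### Markov processes on a finite state space -/

/-- The semigroup `exp (t L)` generated by a linear operator `L` on the (finite-dimensional) space
of functions on a finite set `S`. -/
def markovSemigroup {S : Type*} [Fintype S] (L : (S → ℝ) →ₗ[ℝ] (S → ℝ)) (t : ℝ≥0) :
    (S → ℝ) →L[ℝ] (S → ℝ) :=
  NormedSpace.exp ((t : ℝ) • LinearMap.toContinuousLinearMap L)

/-- The σ-algebra generated by the process up to (and including) time `s`. -/
abbrev pastSigma {Ω S : Type*} [MeasurableSpace S] (X : ℝ≥0 → Ω → S) (s : ℝ≥0) :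
    MeasurableSpace Ω :=
  ⨆ u : Set.Iic s, MeasurableSpace.comap (X u) inferInstance

/-- `X` is, under `P`, a Markov process with generator `L` on the finite state space `S`
(with arbitrary initial distribution):
`E[f(X_{s+t}) | σ(X_u, u ≤ s)] = (exp(tL) f)(X_s)` almost surely. -/
structure IsMarkovProcess {Ω S : Type*} [MeasurableSpace Ω] [Fintype S] [MeasurableSpace S]
    (L : (S → ℝ) →ₗ[ℝ] (S → ℝ)) (P : Measure Ω) (X : ℝ≥0 → Ω → S) : Prop where
  measurable : ∀ t, Measurable (X t)
  markov : ∀ (s t : ℝ≥0) (f : S → ℝ),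
    P[fun ω => f (X (s + t) ω) | pastSigma X s] =ᵐ[P]
      fun ω => markovSemigroup L t f (X s ω)

/-! ### The channel

The channel `{1, …, N}` with `N = n + 1` sites is indexed by `Fin (n + 1)`:
the index `x` stands for the site `x + 1`, so `0` is the site `1` and `Fin.last n` the site `N`. -/

/-- Particle configurations in the channel with `n + 1` sites. -/
abbrev Config (n : ℕ) := Fin (n + 1) → Bool

/-- The number `η(x) ∈ {0, 1}` of particles at a site, as a real number. -/
def occ {n : ℕ} (η : Config n) (x : Fin (n + 1)) : ℝ := if η x then 1 else 0

/-- The configuration in which the contents of the sites `x` and `y` are exchanged. -/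
def exchange {n : ℕ} (x y : Fin (n + 1)) (η : Config n) : Config n :=
  fun z => η (Equiv.swap x y z)

/-- The configuration in which the occupation of the site `x` is flipped. -/
def flipAt {n : ℕ} (x : Fin (n + 1)) (η : Config n) : Config n :=
  Function.update η x (!(η x))

/-- The rate at which a site holding `a ∈ {0, 1}` particles is flipped by a reservoir of
density `v`: a particle leaves at rate `(1 - v) / 2` and enters at rate `v / 2`. -/
def boundaryRate (v a : ℝ) : ℝ := 1 / 2 * (1 - v) * a + 1 / 2 * v * (1 - a)

/-! ### The exclusion process coupled to two finite reservoirs -/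

/-- The state space `{0,1}^N × {0,…,M} × {0,…,M}` of triples `(η, n₋, n₊)`. -/
abbrev State (n M : ℕ) := Config n × Fin (M + 1) × Fin (M + 1)

/-- The density `n₋ / M` of the left reservoir. -/
def leftDensity {n M : ℕ} (ω : State n M) : ℝ := ((ω.2.1 : ℕ) : ℝ) / M

/-- The density `n₊ / M` of the right reservoir. -/
def rightDensity {n M : ℕ} (ω : State n M) : ℝ := ((ω.2.2 : ℕ) : ℝ) / M

/-- The new particle number of a reservoir holding `k` particles, after the exchange of a particle
with the adjacent site: `k + 1` if that site was occupied, `k - 1` if it was empty.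
(The truncation at `0` and `M` only concerns transitions of rate zero.) -/
def reservoirUpdate {M : ℕ} (occupied : Bool) (k : Fin (M + 1)) : Fin (M + 1) :=
  if occupied then ⟨min M (k + 1), by omega⟩ else ⟨k - 1, by omega⟩

/-- The state `ω¹`: a particle is exchanged between the site `1` and the left reservoir. -/
def leftMove {n M : ℕ} (ω : State n M) : State n M :=
  (flipAt 0 ω.1, reservoirUpdate (ω.1 0) ω.2.1, ω.2.2)

/-- The state `ω^N`: a particle is exchanged between the site `N` and the right reservoir. -/
def rightMove {n M : ℕ} (ω : State n M) : State n M :=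
  (flipAt (Fin.last n) ω.1, ω.2.1, reservoirUpdate (ω.1 (Fin.last n)) ω.2.2)

/-- The generator of the symmetric simple exclusion process in a channel of `n + 1` sites coupled
in mean-field fashion to two reservoirs of size `M`. -/
def reservoirGenerator (n M : ℕ) : (State n M → ℝ) →ₗ[ℝ] (State n M → ℝ) where
  toFun f ω :=
    1 / 2 * ∑ x : Fin n, (f (exchange x.castSucc x.succ ω.1, ω.2) - f ω)
      + boundaryRate (rightDensity ω) (occ ω.1 (Fin.last n)) * (f (rightMove ω) - f ω)
      + boundaryRate (leftDensity ω) (occ ω.1 0) * (f (leftMove ω) - f ω)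
  map_add' f g := by
    funext ω
    simp only [Pi.add_apply, Finset.sum_sub_distrib, Finset.sum_add_distrib]
    ring
  map_smul' c f := by
    funext ω
    simp only [Pi.smul_apply, smul_eq_mul, RingHom.id_apply, ← mul_sub, ← Finset.mul_sum]
    ring

/-! ### The exclusion process with ideal reservoirs -/

/-- The generator of the symmetric simple exclusion process in a channel of `n + 1` sites with
ideal reservoirs (birth-death processes at the end sites) of fixed densities `vl` (left)
and `vr` (right). -/
def idealGenerator (n : ℕ) (vl vr : ℝ) : (Config n → ℝ) →ₗ[ℝ] (Config n → ℝ) where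
  toFun f η :=
    1 / 2 * ∑ x : Fin n, (f (exchange x.castSucc x.succ η) - f η)
      + boundaryRate vr (occ η (Fin.last n)) * (f (flipAt (Fin.last n) η) - f η)
      + boundaryRate vl (occ η 0) * (f (flipAt 0 η) - f η)
  map_add' f g := by
    funext η
    simp only [Pi.add_apply, Finset.sum_sub_distrib, Finset.sum_add_distrib]
    ring
  map_smul' c f := by
    funext η
    simp only [Pi.smul_apply, smul_eq_mul, RingHom.id_apply, ← mul_sub, ← Finset.mul_sum]
    ring

end

/-! ### Expectations along a Markov process -/

section MarkovProcess

variable {Ω S : Type*} [MeasurableSpace Ω] [Fintype S] [MeasurableSpace S]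
  [MeasurableSingletonClass S]

theorem integrable_comp_of_finite {P : Measure Ω} [IsFiniteMeasure P] {Z : Ω → S}
    (hZ : Measurable Z) (f : S → ℝ) : Integrable (fun ω => f (Z ω)) P :=
  (Integrable.of_finite (f := f) (μ := P.map Z)).comp_measurable hZ

/-- The expectation of an observable of a random variable with finitely many values, as a
continuous linear functional of the observable. -/
noncomputable def expectationCLM (P : Measure Ω) [IsFiniteMeasure P] {Z : Ω → S}
    (hZ : Measurable Z) : (S → ℝ) →L[ℝ] ℝ :=
  LinearMap.toContinuousLinearMap
    { toFun := fun f => ∫ ω, f (Z ω) ∂P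
      map_add' := fun f g =>
        integral_add (integrable_comp_of_finite hZ f) (integrable_comp_of_finite hZ g)
      map_smul' := fun c f => integral_const_mul c fun ω => f (Z ω) }

namespace IsMarkovProcess

variable {L : (S → ℝ) →ₗ[ℝ] (S → ℝ)} {P : Measure Ω} [IsProbabilityMeasure P]
  {X : ℝ≥0 → Ω → S}

/-- The expectation of `f` at time `t`, computed from the initial law and the semigroup, for every
real time `t`. -/
noncomputable def mean (hX : IsMarkovProcess L P X) (f : S → ℝ) (t : ℝ) : ℝ :=
  expectationCLM P (hX.measurable 0)
    (NormedSpace.exp (t • LinearMap.toContinuousLinearMap L) f)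

theorem integral_eq_mean (hX : IsMarkovProcess L P X) (f : S → ℝ) (t : ℝ≥0) :
    ∫ ω, f (X t ω) ∂P = hX.mean f t := by
  have hm : pastSigma X 0 ≤ (inferInstance : MeasurableSpace Ω) :=
    iSup_le fun u => (hX.measurable u).comap_le
  have h := integral_congr_ae (hX.markov 0 t f)
  rw [integral_condExp hm, zero_add] at h
  exact h

theorem hasDerivAt_mean (hX : IsMarkovProcess L P X) (f : S → ℝ) (t : ℝ) :
    HasDerivAt (hX.mean f) (hX.mean (L f) t) t := by
  have h := hasDerivAt_exp_smul_const (𝕂 := ℝ) (LinearMap.toContinuousLinearMap L) t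
  have h2 := h.clm_apply (hasDerivAt_const t f)
  have h3 := (expectationCLM P (hX.measurable 0)).hasFDerivAt.comp_hasDerivAt t h2
  refine h3.congr_deriv ?_
  simp [mean]

theorem mean_add (hX : IsMarkovProcess L P X) (f g : S → ℝ) (t : ℝ) :
    hX.mean (f + g) t = hX.mean f t + hX.mean g t := by
  simp [mean]

theorem mean_sub (hX : IsMarkovProcess L P X) (f g : S → ℝ) (t : ℝ) :
    hX.mean (f - g) t = hX.mean f t - hX.mean g t := by
  simp [mean]

theorem mean_smul (hX : IsMarkovProcess L P X) (c : ℝ) (f : S → ℝ) (t : ℝ) :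
    hX.mean (c • f) t = c * hX.mean f t := by
  simp [mean]

theorem mean_const (hX : IsMarkovProcess L P X) (c : ℝ) {t : ℝ} (ht : 0 ≤ t) :
    hX.mean (fun _ => c) t = c := by
  lift t to ℝ≥0 using ht
  simp [← hX.integral_eq_mean]

theorem mean_mem_Icc (hX : IsMarkovProcess L P X) {f : S → ℝ} {a b : ℝ}
    (hf : ∀ s, f s ∈ Set.Icc a b) {t : ℝ} (ht : 0 ≤ t) : hX.mean f t ∈ Set.Icc a b := by
  lift t to ℝ≥0 using ht
  have hi := integrable_comp_of_finite (P := P) (hX.measurable t) f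
  rw [← hX.integral_eq_mean]
  constructor
  · simpa using integral_mono (integrable_const a) hi fun ω => (hf _).1
  · simpa using integral_mono hi (integrable_const b) fun ω => (hf _).2

/-- An observable whose image under the generator is at most `C` in absolute value drifts at speed
at most `C` in mean. -/
theorem abs_mean_sub_mean_zero_le (hX : IsMarkovProcess L P X) {f : S → ℝ} {C : ℝ}
    (hf : ∀ s, |L f s| ≤ C) {t : ℝ} (ht : 0 ≤ t) : |hX.mean f t - hX.mean f 0| ≤ C * t := by
  have h := (convex_Icc (0 : ℝ) t).norm_image_sub_le_of_norm_hasDerivWithin_le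
    (f := hX.mean f) (f' := hX.mean (L f)) (C := C) (x := 0) (y := t)
    (fun s _ => (hX.hasDerivAt_mean f s).hasDerivWithinAt)
    (fun s hs => abs_le.2 (hX.mean_mem_Icc (fun x => abs_le.1 (hf x)) hs.1))
    (Set.left_mem_Icc.2 ht) (Set.right_mem_Icc.2 ht)
  simpa [abs_of_nonneg ht] using h

end IsMarkovProcess

end MarkovProcess

/-! ### The discrete heat equation -/

theorem sum_secondDiff (a : ℕ → ℝ) (n : ℕ) :
    ∑ k ∈ Finset.range (n + 1), (a k + a (k + 2) - 2 * a (k + 1))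
      = a 0 - a 1 + a (n + 2) - a (n + 1) := by
  induction n with
  | zero => simp; ring
  | succ n ih => rw [Finset.sum_range_succ, ih]; ring

theorem sum_mul_secondDiff (a : ℕ → ℝ) (n : ℕ) :
    ∑ k ∈ Finset.range (n + 1), ((k : ℝ) + 1) * (a k + a (k + 2) - 2 * a (k + 1))
      = a 0 + (n + 1) * a (n + 2) - (n + 2) * a (n + 1) := by
  induction n with
  | zero => simp
  | succ n ih => rw [Finset.sum_range_succ, ih]; push_cast; ring

theorem hasDerivAt_max_zero_sq (x : ℝ) :
    HasDerivAt (fun y : ℝ => max y 0 ^ 2) (2 * max x 0) x := by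
  rcases lt_trichotomy x 0 with hx | rfl | hx
  · rw [max_eq_right hx.le, mul_zero]
    refine (hasDerivAt_const x (0 : ℝ)).congr_of_eventuallyEq ?_
    filter_upwards [gt_mem_nhds hx] with y hy
    simp [max_eq_right hy.le]
  · rw [max_self, mul_zero]
    refine HasDerivAt.of_isLittleO ?_
    simp only [smul_zero, sub_zero, max_self]
    refine Asymptotics.IsBigO.trans_isLittleO (g := fun y : ℝ => y ^ 2) ?_ ?_
    · refine Asymptotics.IsBigO.of_bound 1 (Eventually.of_forall fun y => ?_)
      rcases le_total y 0 with h | h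
      · simp [max_eq_right h, sq_nonneg]
      · simp [max_eq_left h]
    · exact Asymptotics.isLittleO_pow_id one_lt_two
  · rw [max_eq_left hx.le]
    have h : HasDerivAt (fun y : ℝ => y ^ 2) (2 * x) x := by simpa using hasDerivAt_pow 2 x
    refine h.congr_of_eventuallyEq ?_
    filter_upwards [lt_mem_nhds hx] with y hy
    simp [max_eq_left hy.le]

/-- The Dirichlet form of the positive part of a function that is nonpositive at both ends. -/
theorem sum_posPart_mul_secondDiff_nonpos (z : ℕ → ℝ) (n : ℕ) (h0 : z 0 ≤ 0)
    (hn : z (n + 2) ≤ 0) :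
    ∑ k ∈ Finset.range (n + 1),
      2 * max (z (k + 1)) 0 * (1 / 2 * (z k + z (k + 2) - 2 * z (k + 1))) ≤ 0 := by
  have hp : ∀ k, 0 ≤ max (z k) 0 ∧ z k ≤ max (z k) 0 := fun k =>
    ⟨le_max_right _ _, le_max_left _ _⟩
  have hm : ∀ k, max (z k) 0 * z k = max (z k) 0 ^ 2 := fun k => by
    rcases le_total (z k) 0 with h | h
    · simp [max_eq_right h]
    · simp [max_eq_left h, sq]
  calc _ ≤ ∑ k ∈ Finset.range (n + 1), 1 / 2 *
        (max (z k) 0 ^ 2 + max (z (k + 2)) 0 ^ 2 - 2 * max (z (k + 1)) 0 ^ 2) := by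
        refine Finset.sum_le_sum fun k _ => ?_
        have h1 := mul_le_mul_of_nonneg_left (hp k).2 (hp (k + 1)).1
        have h2 := mul_le_mul_of_nonneg_left (hp (k + 2)).2 (hp (k + 1)).1
        nlinarith [sq_nonneg (max (z (k + 1)) 0 - max (z k) 0),
          sq_nonneg (max (z (k + 1)) 0 - max (z (k + 2)) 0), hm (k + 1)]
    _ = 1 / 2 * (max (z 0) 0 ^ 2 - max (z 1) 0 ^ 2 + max (z (n + 2)) 0 ^ 2
          - max (z (n + 1)) 0 ^ 2) := by
        rw [← Finset.mul_sum, sum_secondDiff fun k => max (z k) 0 ^ 2]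
    _ ≤ 0 := by
        rw [max_eq_right h0, max_eq_right hn]
        nlinarith [sq_nonneg (max (z 1) 0), sq_nonneg (max (z (n + 1)) 0)]

/-- The maximum principle for the discrete heat equation in the sites `1, …, n + 1`, with boundary
values at the sites `0` and `n + 2`. -/
theorem discreteHeat_le (n : ℕ) (w : ℕ → ℝ → ℝ) (T ε : ℝ)
    (hw : ∀ k < n + 1, ∀ t, 0 ≤ t → HasDerivAt (w (k + 1))
      (1 / 2 * (w k t + w (k + 2) t - 2 * w (k + 1) t)) t)
    (h0 : ∀ t ∈ Set.Icc 0 T, w 0 t ≤ ε) (hn : ∀ t ∈ Set.Icc 0 T, w (n + 2) t ≤ ε)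
    (hi : ∀ k < n + 1, w (k + 1) 0 ≤ ε) {k : ℕ} (hk : k < n + 1) {t : ℝ}
    (ht : t ∈ Set.Icc 0 T) : w (k + 1) t ≤ ε := by
  set F : ℝ → ℝ := fun s => ∑ k ∈ Finset.range (n + 1), max (w (k + 1) s - ε) 0 ^ 2 with hF
  have hd : ∀ s ∈ Set.Icc 0 T, HasDerivAt F (∑ k ∈ Finset.range (n + 1),
      2 * max (w (k + 1) s - ε) 0 *
        (1 / 2 * ((w k s - ε) + (w (k + 2) s - ε) - 2 * (w (k + 1) s - ε)))) s := by
    intro s hs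
    refine HasDerivAt.fun_sum fun k hk => ?_
    have h1 := (hw k (Finset.mem_range.1 hk) s hs.1).sub_const ε
    have h2 := (hasDerivAt_max_zero_sq (w (k + 1) s - ε)).comp s h1
    refine h2.congr_deriv ?_
    ring
  have hanti : AntitoneOn F (Set.Icc 0 T) := by
    refine antitoneOn_of_hasDerivWithinAt_nonpos (convex_Icc 0 T)
      (fun s hs => (hd s hs).continuousAt.continuousWithinAt)
      (fun s hs => (hd s (interior_subset hs)).hasDerivWithinAt) fun s hs => ?_
    have hs' := interior_subset hs
    exact sum_posPart_mul_secondDiff_nonpos (fun k => w k s - ε) n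
      (sub_nonpos.2 (h0 s hs')) (sub_nonpos.2 (hn s hs'))
  have hF0 : F 0 = 0 := Finset.sum_eq_zero fun k hk => by
    rw [max_eq_right (sub_nonpos.2 (hi k (Finset.mem_range.1 hk)))]; norm_num
  have hFt : F t ≤ 0 := hF0 ▸ hanti (Set.left_mem_Icc.2 (ht.1.trans ht.2)) ht ht.1
  have h1 : max (w (k + 1) t - ε) 0 ^ 2 ≤ F t :=
    Finset.single_le_sum (f := fun k => max (w (k + 1) t - ε) 0 ^ 2)
      (fun _ _ => sq_nonneg _) (Finset.mem_range.2 hk)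
  have h2 : max (w (k + 1) t - ε) 0 = 0 := by
    nlinarith [sq_nonneg (max (w (k + 1) t - ε) 0)]
  linarith [le_max_left (w (k + 1) t - ε) 0]

theorem abs_discreteHeat_le (n : ℕ) (w : ℕ → ℝ → ℝ) (T ε : ℝ)
    (hw : ∀ k < n + 1, ∀ t, 0 ≤ t → HasDerivAt (w (k + 1))
      (1 / 2 * (w k t + w (k + 2) t - 2 * w (k + 1) t)) t)
    (h0 : ∀ t ∈ Set.Icc 0 T, |w 0 t| ≤ ε) (hn : ∀ t ∈ Set.Icc 0 T, |w (n + 2) t| ≤ ε)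
    (hi : ∀ k < n + 1, |w (k + 1) 0| ≤ ε) {k : ℕ} (hk : k < n + 1) {t : ℝ}
    (ht : t ∈ Set.Icc 0 T) : |w (k + 1) t| ≤ ε := by
  refine abs_le'.2 ⟨discreteHeat_le n w T ε hw (fun s hs => (abs_le'.1 (h0 s hs)).1)
    (fun s hs => (abs_le'.1 (hn s hs)).1) (fun j hj => (abs_le'.1 (hi j hj)).1) hk ht, ?_⟩
  refine discreteHeat_le n (fun k s => -w k s) T ε (fun j hj s hs => ?_)
    (fun s hs => (abs_le'.1 (h0 s hs)).2)
    (fun s hs => (abs_le'.1 (hn s hs)).2) (fun j hj => (abs_le'.1 (hi j hj)).2) hk ht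
  refine (hw j hj s hs).neg.congr_deriv ?_
  ring

/-! ### The density profile and the generators -/

/-- The occupation numbers of the sites `1, …, n + 1`, extended by the reservoir densities `l` at
the site `0` and `r` at all sites beyond `n + 1`. -/
noncomputable def profile {n : ℕ} (l r : ℝ) (η : Config n) : ℕ → ℝ
  | 0 => l
  | k + 1 => if h : k < n + 1 then occ η ⟨k, h⟩ else r

theorem occ_mem_Icc {n : ℕ} (η : Config n) (x : Fin (n + 1)) : occ η x ∈ Set.Icc (0 : ℝ) 1 := by
  unfold occ; split_ifs <;> simp

theorem profile_mem_Icc {n : ℕ} {l r : ℝ} (hl : l ∈ Set.Icc (0 : ℝ) 1)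
    (hr : r ∈ Set.Icc (0 : ℝ) 1) (η : Config n) (k : ℕ) :
    profile l r η k ∈ Set.Icc (0 : ℝ) 1 := by
  cases k with
  | zero => exact hl
  | succ k => simp only [profile]; split_ifs; exacts [occ_mem_Icc _ _, hr]

theorem profile_last {n : ℕ} (l r : ℝ) (η : Config n) : profile l r η (n + 2) = r := by
  simp [profile]

theorem profile_site {n : ℕ} (l r : ℝ) (η : Config n) (x : Fin (n + 1)) :
    profile l r η (x + 1) = occ η x := dif_pos x.2

theorem occ_exchange_sub {n : ℕ} (η : Config n) (y : Fin n) (x : Fin (n + 1)) :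
    occ (exchange y.castSucc y.succ η) x - occ η x
      = (if x = y.castSucc then occ η y.succ - occ η x else 0)
        + (if x = y.succ then occ η y.castSucc - occ η x else 0) := by
  have hne : y.castSucc ≠ y.succ := (Fin.castSucc_lt_succ).ne
  by_cases h1 : x = y.castSucc
  · subst h1; simp [occ, exchange, hne]
  · by_cases h2 : x = y.succ
    · subst h2; simp [occ, exchange, hne.symm]
    · simp [occ, exchange, h1, h2, Equiv.swap_apply_of_ne_of_ne h1 h2]

theorem boundaryRate_mul_occ_flipAt {n : ℕ} (η : Config n) (v : ℝ) (y x : Fin (n + 1)) :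
    boundaryRate v (occ η y) * (occ (flipAt y η) x - occ η x)
      = if x = y then 1 / 2 * (v - occ η x) else 0 := by
  by_cases h : x = y
  · subst h
    cases hx : η x <;> simp [occ, flipAt, boundaryRate, hx]; ring
  · simp [occ, flipAt, h]

theorem sum_occ_succ_sub {n : ℕ} (l r : ℝ) (η : Config n) (x : Fin (n + 1)) :
    (∑ y : Fin n, if x = y.castSucc then occ η y.succ - occ η x else 0)
      + (if x = Fin.last n then r - occ η x else 0) = profile l r η (x + 2) - occ η x := by
  induction x using Fin.lastCases with
  | last => simp [profile, (Fin.castSucc_lt_last _).ne']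
  | cast x =>
    simp only [Fin.castSucc_inj, (Fin.castSucc_lt_last x).ne, if_false, add_zero,
      Finset.sum_ite_eq, Finset.mem_univ, if_true]
    have := profile_site l r η x.succ
    simpa using this.symm

theorem sum_occ_castSucc_sub {n : ℕ} (l r : ℝ) (η : Config n) (x : Fin (n + 1)) :
    (∑ y : Fin n, if x = y.succ then occ η y.castSucc - occ η x else 0)
      + (if x = 0 then l - occ η x else 0) = profile l r η x - occ η x := by
  induction x using Fin.cases with
  | zero => simp [profile, (Fin.succ_ne_zero _).symm]
  | succ x =>
    simp only [Fin.succ_inj, Fin.succ_ne_zero, if_false, add_zero,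
      Finset.sum_ite_eq, Finset.mem_univ, if_true]
    have := profile_site l r η x.castSucc
    simpa using this.symm

/-- Exclusion dynamics with reservoir densities `l` and `r` acts on occupation numbers as half the
discrete Laplacian. -/
theorem exclusion_occ {n : ℕ} (l r : ℝ) (η : Config n) (x : Fin (n + 1)) :
    1 / 2 * ∑ y : Fin n, (occ (exchange y.castSucc y.succ η) x - occ η x)
      + boundaryRate r (occ η (Fin.last n)) * (occ (flipAt (Fin.last n) η) x - occ η x)
      + boundaryRate l (occ η 0) * (occ (flipAt 0 η) x - occ η x)
      = 1 / 2 * (profile l r η x + profile l r η (x + 2) - 2 * profile l r η (x + 1)) := by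
  simp only [occ_exchange_sub, boundaryRate_mul_occ_flipAt, Finset.sum_add_distrib, profile_site]
  have h1 := sum_occ_succ_sub l r η x
  have h2 := sum_occ_castSucc_sub l r η x
  split_ifs at h1 h2 ⊢ <;> linarith

theorem idealGenerator_profile {n : ℕ} (l r : ℝ) {k : ℕ} (hk : k < n + 1) (η : Config n) :
    idealGenerator n l r (fun η => profile l r η (k + 1)) η
      = 1 / 2 * (profile l r η k + profile l r η (k + 2) - 2 * profile l r η (k + 1)) := by
  have h : (fun η : Config n => profile l r η (k + 1)) = fun η => occ η ⟨k, hk⟩ :=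
    funext fun η => profile_site l r η ⟨k, hk⟩
  rw [h]
  exact exclusion_occ l r η ⟨k, hk⟩

/-- The profile of a state of the process with finite reservoirs. -/
noncomputable def stateProfile {n M : ℕ} (k : ℕ) (ω : State n M) : ℝ :=
  profile (leftDensity ω) (rightDensity ω) ω.1 k

theorem density_mem_Icc {M : ℕ} (k : Fin (M + 1)) : ((k : ℕ) : ℝ) / M ∈ Set.Icc (0 : ℝ) 1 :=
  ⟨by positivity, div_le_one_of_le₀ (by exact_mod_cast Fin.is_le k) (by positivity)⟩

theorem stateProfile_mem_Icc {n M : ℕ} (k : ℕ) (ω : State n M) :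
    stateProfile k ω ∈ Set.Icc (0 : ℝ) 1 :=
  profile_mem_Icc (density_mem_Icc ω.2.1) (density_mem_Icc ω.2.2) ω.1 k

theorem reservoirGenerator_stateProfile {n M : ℕ} {k : ℕ} (hk : k < n + 1) (ω : State n M) :
    reservoirGenerator n M (stateProfile (k + 1)) ω
      = 1 / 2 * (stateProfile k ω + stateProfile (k + 2) ω - 2 * stateProfile (k + 1) ω) := by
  have h : (stateProfile (k + 1) : State n M → ℝ) = fun ω => occ ω.1 ⟨k, hk⟩ :=
    funext fun ω => profile_site _ _ ω.1 ⟨k, hk⟩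
  have h1 : reservoirGenerator n M (fun ω => occ ω.1 ⟨k, hk⟩) ω = _ :=
    exclusion_occ (leftDensity ω) (rightDensity ω) ω.1 ⟨k, hk⟩
  rw [← h] at h1
  exact h1

theorem boundaryRate_mul_reservoirUpdate {M : ℕ} (hM : 0 < M) (b : Bool) (k : Fin (M + 1)) :
    boundaryRate ((k : ℕ) / M) (if b then 1 else 0)
        * (((reservoirUpdate b k : Fin (M + 1)) : ℕ) / M - (k : ℕ) / M : ℝ)
      = 1 / 2 * ((if b then 1 else 0) - (k : ℕ) / M) / M := by
  have hM' : (M : ℝ) ≠ 0 := by positivity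
  cases b with
  | true =>
    rcases (Fin.is_le k).eq_or_lt with h | h
    · simp [boundaryRate, reservoirUpdate, h, hM']
    · have : min M ((k : ℕ) + 1) = k + 1 := min_eq_right h
      simp [boundaryRate, reservoirUpdate, this]
      ring
  | false =>
    rcases Nat.eq_zero_or_pos (k : ℕ) with h | h
    · simp [boundaryRate, reservoirUpdate, h]
    · simp [boundaryRate, reservoirUpdate, Nat.cast_sub h]
      ring

theorem reservoirGenerator_leftDensity {n M : ℕ} (hM : 0 < M) (ω : State n M) :
    reservoirGenerator n M (stateProfile 0) ω
      = 1 / 2 * (stateProfile 1 ω - stateProfile 0 ω) / M := by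
  have h := boundaryRate_mul_reservoirUpdate hM (ω.1 0) ω.2.1
  have h1 : stateProfile 1 ω = occ ω.1 0 := profile_site _ _ ω.1 0
  rw [h1]
  simpa [reservoirGenerator, stateProfile, profile, leftDensity, rightMove, leftMove, occ] using h

theorem reservoirGenerator_rightDensity {n M : ℕ} (hM : 0 < M) (ω : State n M) :
    reservoirGenerator n M (stateProfile (n + 2)) ω
      = 1 / 2 * (stateProfile (n + 1) ω - stateProfile (n + 2) ω) / M := by
  have h := boundaryRate_mul_reservoirUpdate hM (ω.1 (Fin.last n)) ω.2.2
  have h1 : stateProfile (n + 1) ω = occ ω.1 (Fin.last n) := profile_site _ _ ω.1 (Fin.last n)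
  rw [h1]
  simpa [reservoirGenerator, stateProfile, profile, rightDensity, rightMove, leftMove, occ] using h

/-! ### Slow variation of the reservoir densities -/

theorem sum_mul_stateProfile_mem_Icc {n M : ℕ} (c : ℕ → ℝ)
    (hc : ∀ k < n + 1, c k ∈ Set.Icc (0 : ℝ) 1) (ω : State n M) :
    (∑ k ∈ Finset.range (n + 1), c k • (stateProfile (k + 1) : State n M → ℝ)) ω
      ∈ Set.Icc (0 : ℝ) (n + 1) := by
  simp only [Finset.sum_apply, Pi.smul_apply, smul_eq_mul]
  have h : ∀ k ∈ Finset.range (n + 1), c k * stateProfile (k + 1) ω ∈ Set.Icc (0 : ℝ) 1 :=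
    fun k hk => unitInterval.mul_mem (hc k (Finset.mem_range.1 hk)) (stateProfile_mem_Icc _ _)
  refine ⟨Finset.sum_nonneg fun k hk => (h k hk).1, ?_⟩
  simpa using Finset.sum_le_card_nsmul _ _ 1 fun k hk => (h k hk).2

/-- The total number of particles in the channel and the reservoirs is conserved. -/
theorem reservoirGenerator_mass {n M : ℕ} (hM : 0 < M) (ω : State n M) :
    reservoirGenerator n M ((M : ℝ) • (stateProfile 0 + stateProfile (n + 2))
      + ∑ k ∈ Finset.range (n + 1), (1 : ℝ) • stateProfile (k + 1)) ω = 0 := by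
  have hM' : (M : ℝ) ≠ 0 := by positivity
  simp only [map_add, map_smul, map_sum, Pi.add_apply, Pi.smul_apply, Finset.sum_apply,
    smul_eq_mul, one_mul, reservoirGenerator_leftDensity hM, reservoirGenerator_rightDensity hM]
  rw [Finset.sum_congr rfl fun k hk =>
    reservoirGenerator_stateProfile (Finset.mem_range.1 hk) ω, ← Finset.mul_sum,
    sum_secondDiff fun k => stateProfile k ω]
  field_simp
  ring

/-- The particle number of the right reservoir, corrected by the particles of the channel with
weights growing linearly from left to right, evolves at rate of order `1 / n`. -/
theorem reservoirGenerator_weightedMass {n M : ℕ} (hM : 0 < M) (ω : State n M) :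
    reservoirGenerator n M ((M : ℝ) • stateProfile (n + 2)
      + ∑ k ∈ Finset.range (n + 1), (((k : ℝ) + 1) / (n + 2)) • stateProfile (k + 1)) ω
      = (stateProfile 0 ω - stateProfile (n + 2) ω) / (2 * (n + 2)) := by
  have hM' : (M : ℝ) ≠ 0 := by positivity
  have hn : (n : ℝ) + 2 ≠ 0 := by positivity
  simp only [map_add, map_smul, map_sum, Pi.add_apply, Pi.smul_apply, Finset.sum_apply,
    smul_eq_mul, reservoirGenerator_rightDensity hM]
  have h : ∀ k ∈ Finset.range (n + 1),
      ((k : ℝ) + 1) / (n + 2) * reservoirGenerator n M (stateProfile (k + 1)) ω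
        = 1 / (2 * (n + 2)) * (((k : ℝ) + 1) * (stateProfile k ω + stateProfile (k + 2) ω
          - 2 * stateProfile (k + 1) ω)) := fun k hk => by
    rw [reservoirGenerator_stateProfile (Finset.mem_range.1 hk) ω]
    field_simp
  rw [Finset.sum_congr rfl h, ← Finset.mul_sum, sum_mul_secondDiff fun k => stateProfile k ω]
  field_simp
  ring

section Reservoir

variable {Ω : Type*} [MeasurableSpace Ω] {n M : ℕ} {P : Measure Ω} [IsProbabilityMeasure P]
  {X : ℝ≥0 → Ω → State n M}

theorem abs_mean_rightDensity_sub_le (hM : 0 < M)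
    (hX : IsMarkovProcess (reservoirGenerator n M) P X) {t : ℝ} (ht : 0 ≤ t) :
    M * |hX.mean (stateProfile (n + 2)) t - hX.mean (stateProfile (n + 2)) 0|
      ≤ (n + 1) + t / (n + 1) := by
  have hn : (0 : ℝ) < n + 1 := by positivity
  have hdrift : ∀ ω, |reservoirGenerator n M ((M : ℝ) • stateProfile (n + 2)
      + ∑ k ∈ Finset.range (n + 1), (((k : ℝ) + 1) / (n + 2)) • stateProfile (k + 1)) ω|
      ≤ 1 / (n + 1) := fun ω => by
    rw [reservoirGenerator_weightedMass hM, abs_div,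
      abs_of_pos (by positivity : (0 : ℝ) < 2 * (n + 2))]
    have h1 := stateProfile_mem_Icc 0 ω
    have h2 := stateProfile_mem_Icc (n + 2) ω
    exact div_le_div₀ zero_le_one (abs_le.2 ⟨by linarith [h1.1, h2.2], by linarith [h1.2, h2.1]⟩)
      hn (by linarith)
  have h := hX.abs_mean_sub_mean_zero_le hdrift ht
  have hc : ∀ k < n + 1, ((k : ℝ) + 1) / (n + 2) ∈ Set.Icc (0 : ℝ) 1 := fun k hk => by
    have : (k : ℝ) + 1 ≤ n + 1 := by exact_mod_cast hk
    exact ⟨by positivity, (div_le_one (by positivity)).2 (by linarith)⟩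
  have hs := fun s (hs : (0 : ℝ) ≤ s) =>
    hX.mean_mem_Icc (sum_mul_stateProfile_mem_Icc (fun k : ℕ => ((k : ℝ) + 1) / (n + 2)) hc) hs
  have h0 := hs 0 le_rfl
  have h1 := hs t ht
  simp only [hX.mean_add, hX.mean_smul] at h
  rw [← abs_of_nonneg (Nat.cast_nonneg (α := ℝ) M), ← abs_mul, mul_sub]
  rw [one_div_mul_eq_div] at h
  rw [abs_le] at h ⊢
  constructor <;> linarith [h.1, h.2, h0.1, h0.2, h1.1, h1.2]

theorem abs_mean_leftDensity_sub_le (hM : 0 < M)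
    (hX : IsMarkovProcess (reservoirGenerator n M) P X) {t : ℝ} (ht : 0 ≤ t) :
    M * |hX.mean (stateProfile 0) t - hX.mean (stateProfile 0) 0|
      ≤ 2 * (n + 1) + t / (n + 1) := by
  have h := hX.abs_mean_sub_mean_zero_le (C := 0)
    (fun ω => by rw [reservoirGenerator_mass hM, abs_zero]) ht
  have hs := fun s (hs : (0 : ℝ) ≤ s) =>
    hX.mean_mem_Icc (sum_mul_stateProfile_mem_Icc (fun _ : ℕ => (1 : ℝ)) fun _ _ => by simp) hs
  have h0 := hs 0 le_rfl
  have h1 := hs t ht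
  have hr := abs_mean_rightDensity_sub_le hM hX ht
  simp only [hX.mean_add, hX.mean_smul] at h
  have hM0 : |(M : ℝ)| = M := abs_of_nonneg (Nat.cast_nonneg M)
  rw [← hM0, ← abs_mul, mul_sub, abs_le] at hr ⊢
  rw [zero_mul, abs_le] at h
  constructor <;> linarith [h.1, h.2, h0.1, h0.2, h1.1, h1.2, hr.1, hr.2]

/-- Comparison of the mean occupation numbers with finite and with ideal reservoirs. -/
theorem abs_mean_occ_sub_le (hM : 0 < M)
    (hX : IsMarkovProcess (reservoirGenerator n M) P X)
    {Ω' : Type*} [MeasurableSpace Ω'] {Q : Measure Ω'} [IsProbabilityMeasure Q]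
    {Y : ℝ≥0 → Ω' → Config n} {vl vr : ℝ} (hY : IsMarkovProcess (idealGenerator n vl vr) Q Y)
    (h0 : ∀ x, ∫ ω, occ (X 0 ω).1 x ∂P = ∫ ω, occ (Y 0 ω) x ∂Q)
    (x : Fin (n + 1)) (t : ℝ≥0) :
    |(∫ ω, occ (X t ω).1 x ∂P) - ∫ ω, occ (Y t ω) x ∂Q|
      ≤ |(∫ ω, leftDensity (X 0 ω) ∂P) - vl| + |(∫ ω, rightDensity (X 0 ω) ∂P) - vr|
        + (2 * (n + 1) + t / (n + 1)) / M := by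
  have hM' : (0 : ℝ) < M := by exact_mod_cast hM
  have hocc : ∀ (y : Fin (n + 1)) (s : ℝ≥0),
      (∫ ω, occ (X s ω).1 y ∂P) - ∫ ω, occ (Y s ω) y ∂Q
        = hX.mean (stateProfile (y + 1)) s - hY.mean (fun η => profile vl vr η (y + 1)) s := by
    intro y s
    simp only [← hX.integral_eq_mean, ← hY.integral_eq_mean, stateProfile, profile_site]
  have hl0 : ∫ ω, leftDensity (X 0 ω) ∂P = hX.mean (stateProfile 0) 0 :=
    hX.integral_eq_mean (stateProfile 0) 0
  have hr0 : ∫ ω, rightDensity (X 0 ω) ∂P = hX.mean (stateProfile (n + 2)) 0 := by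
    have := hX.integral_eq_mean (stateProfile (n + 2)) 0
    simpa only [stateProfile, profile_last, NNReal.coe_zero] using this
  rw [hocc, hl0, hr0]
  refine abs_discreteHeat_le n
    (fun k s => hX.mean (stateProfile k) s - hY.mean (fun η => profile vl vr η k) s) t _
    ?_ ?_ ?_ ?_ x.2 ⟨t.2, le_rfl⟩
  · intro k hk s _
    refine ((hX.hasDerivAt_mean _ s).sub (hY.hasDerivAt_mean _ s)).congr_deriv ?_
    have e1 : reservoirGenerator n M (stateProfile (k + 1))
        = (1 / 2 : ℝ) • (stateProfile k + stateProfile (k + 2) - (2 : ℝ) • stateProfile (k + 1)) :=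
      funext fun ω => reservoirGenerator_stateProfile hk ω
    have e2 : idealGenerator n vl vr (fun η => profile vl vr η (k + 1))
        = (1 / 2 : ℝ) • ((fun η => profile vl vr η k) + (fun η => profile vl vr η (k + 2))
          - (2 : ℝ) • fun η => profile vl vr η (k + 1)) :=
      funext fun η => idealGenerator_profile vl vr hk η
    rw [e1, e2]
    simp only [hX.mean_smul, hX.mean_sub, hX.mean_add, hY.mean_smul, hY.mean_sub, hY.mean_add]
    ring
  · intro s hs
    have e : hY.mean (fun η => profile vl vr η 0) s = vl := hY.mean_const vl hs.1
    have h1 := abs_mean_leftDensity_sub_le hM hX hs.1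
    have h2 : |hX.mean (stateProfile 0) s - hX.mean (stateProfile 0) 0|
        ≤ (2 * (n + 1) + t / (n + 1)) / M := by
      rw [le_div_iff₀' hM']
      refine h1.trans ?_
      gcongr
      exact hs.2
    have h3 := abs_sub_le (hX.mean (stateProfile 0) s) (hX.mean (stateProfile 0) 0) vl
    simp only [e]
    linarith [abs_nonneg (hX.mean (stateProfile (n + 2)) 0 - vr)]
  · intro s hs
    have e : hY.mean (fun η => profile vl vr η (n + 2)) s = vr := by
      simp only [profile_last]
      exact hY.mean_const vr hs.1
    have h1 := abs_mean_rightDensity_sub_le hM hX hs.1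
    have h2 : |hX.mean (stateProfile (n + 2)) s - hX.mean (stateProfile (n + 2)) 0|
        ≤ (2 * (n + 1) + t / (n + 1)) / M := by
      rw [le_div_iff₀' hM']
      have : s / (n + 1) ≤ t / (n + 1) := by gcongr; exact hs.2
      have : (0 : ℝ) ≤ n := by positivity
      linarith
    have h3 := abs_sub_le (hX.mean (stateProfile (n + 2)) s) (hX.mean (stateProfile (n + 2)) 0) vr
    simp only [e]
    linarith [abs_nonneg (hX.mean (stateProfile 0) 0 - vl)]
  · intro k hk
    have := hocc ⟨k, hk⟩ 0
    rw [h0, sub_self, NNReal.coe_zero] at this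
    rw [← this, abs_zero]
    positivity

end Reservoir

/-! ### The limit -/

/-- Convergence in probability of uniformly bounded random variables to a constant implies
convergence of the expectations. -/
theorem tendsto_abs_integral_sub_of_tendsto_measure {Ω : ℕ → Type*} [∀ n, MeasurableSpace (Ω n)]
    (P : ∀ n, Measure (Ω n)) [∀ n, IsProbabilityMeasure (P n)] (Z : ∀ n, Ω n → ℝ)
    (hZm : ∀ n, Measurable (Z n)) (hZ : ∀ n ω, Z n ω ∈ Set.Icc (0 : ℝ) 1) {v : ℝ}
    (hv : v ∈ Set.Icc (0 : ℝ) 1)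
    (h : ∀ δ : ℝ, 0 < δ → Tendsto (fun n => P n {ω | δ ≤ |Z n ω - v|}) atTop (𝓝 0)) :
    Tendsto (fun n => |(∫ ω, Z n ω ∂(P n)) - v|) atTop (𝓝 0) := by
  have key : ∀ (δ : ℝ) (n : ℕ), 0 < δ →
      |(∫ ω, Z n ω ∂(P n)) - v| ≤ δ + (P n {ω | δ ≤ |Z n ω - v|}).toReal := by
    intro δ n hδ
    have hms : MeasurableSet {ω | δ ≤ |Z n ω - v|} :=
      measurableSet_le measurable_const ((hZm n).sub_const v).abs
    have hi : Integrable (Z n) (P n) :=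
      Integrable.of_bound (hZm n).aestronglyMeasurable 1 (Eventually.of_forall fun ω => by
        rw [Real.norm_eq_abs, abs_of_nonneg (hZ n ω).1]; exact (hZ n ω).2)
    have hind : Integrable ({ω | δ ≤ |Z n ω - v|}.indicator fun _ => (1 : ℝ)) (P n) :=
      (integrable_const 1).indicator hms
    calc |(∫ ω, Z n ω ∂(P n)) - v| = |∫ ω, (Z n ω - v) ∂(P n)| := by
          rw [integral_sub hi (integrable_const v)]; simp
      _ ≤ ∫ ω, |Z n ω - v| ∂(P n) := abs_integral_le_integral_abs
      _ ≤ ∫ ω, (δ + {ω | δ ≤ |Z n ω - v|}.indicator (fun _ => (1 : ℝ)) ω) ∂(P n) := by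
          refine integral_mono (hi.sub (integrable_const v)).abs
            ((integrable_const δ).add hind) fun ω => ?_
          by_cases hω : δ ≤ |Z n ω - v|
          · have h1 : |Z n ω - v| ≤ 1 := abs_le.2
              ⟨by linarith [(hZ n ω).1, hv.2], by linarith [(hZ n ω).2, hv.1]⟩
            simp only [Set.indicator_of_mem (show ω ∈ {ω | δ ≤ |Z n ω - v|} from hω)]
            linarith
          · simp only [Set.indicator_of_notMem (show ω ∉ {ω | δ ≤ |Z n ω - v|} from hω)]
            linarith
      _ = δ + (P n {ω | δ ≤ |Z n ω - v|}).toReal := by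
          rw [integral_add (integrable_const δ) hind, integral_indicator_const _ hms]
          simp [Measure.real]
  rw [Metric.tendsto_atTop]
  intro ε hε
  have h1 : Tendsto (fun n => (P n {ω | ε / 2 ≤ |Z n ω - v|}).toReal) atTop (𝓝 0) := by
    exact (ENNReal.tendsto_toReal ENNReal.zero_ne_top).comp (h (ε / 2) (half_pos hε))
  obtain ⟨n₀, hn₀⟩ := eventually_atTop.1 (h1.eventually_lt_const (half_pos hε))
  refine ⟨n₀, fun n hn => ?_⟩
  rw [Real.dist_eq, sub_zero, abs_abs]
  linarith [key (ε / 2) n (half_pos hε), hn₀ n hn]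

theorem pos_and_half_le_of_abs_sub_lt_one {m : ℕ} {r : ℝ} (hr : 1 ≤ r) (h : |(m : ℝ) - r| < 1) :
    0 < m ∧ r / 2 ≤ m := by
  have h1 := abs_lt.1 h
  have hm : 0 < m := by
    have : (0 : ℝ) < m := by linarith
    exact_mod_cast this
  have : (1 : ℝ) ≤ m := by exact_mod_cast hm
  exact ⟨hm, by linarith⟩

/-- On the time scale `N ^ (2 + α')` the reservoir densities change by at most `C N ^ (α' - α)`. -/
theorem reservoir_drift_le {α α' : ℝ} (hα' : 0 ≤ α') {N m T t : ℝ} (hN : 1 ≤ N)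
    (hm : N ^ (1 + α) / 2 ≤ m) (ht0 : 0 ≤ t) (ht : t ≤ T) :
    (2 * N + N ^ (2 + α') * t / N) / m ≤ (4 + 2 * T) * N ^ (α' - α) := by
  have hN0 : 0 < N := by linarith
  have hm0 : 0 < m := lt_of_lt_of_le (by positivity) hm
  rw [div_le_iff₀ hm0]
  have e1 : N ^ (α' - α) * N ^ (1 + α) = N ^ (1 + α') := by
    rw [← Real.rpow_add hN0]; ring_nf
  have e2 : N ^ (2 + α') = N * N ^ (1 + α') := by
    rw [show 2 + α' = 1 + (1 + α') by ring, Real.rpow_add hN0 1, Real.rpow_one]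
  have e3 : N ≤ N ^ (1 + α') := by
    simpa using Real.rpow_le_rpow_of_exponent_le hN (by linarith : (1 : ℝ) ≤ 1 + α')
  have hp : 0 < N ^ (1 + α') := by positivity
  calc 2 * N + N ^ (2 + α') * t / N = 2 * N + N ^ (1 + α') * t := by
        rw [e2]; field_simp
    _ ≤ 2 * N ^ (1 + α') + N ^ (1 + α') * T := by gcongr
    _ = (4 + 2 * T) * N ^ (α' - α) * (N ^ (1 + α) / 2) := by rw [← e1]; ring
    _ ≤ (4 + 2 * T) * N ^ (α' - α) * m := by
        have : 0 ≤ T := ht0.trans ht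
        gcongr

/-- Ideal reservoir limit. The index `n` corresponds to the channel size `N = n + 1`; under `P n` the
process `X n` is the exclusion process coupled to two reservoirs of size `M n ≈ N ^ (1 + α)`, and
under `Q n` the process `Y n` is the exclusion process with ideal reservoirs. -/
theorem theorem3p1
    (α : ℝ) (hα : 0 < α)
    -- the reservoir size is the integer `N ^ (1 + α)`, up to rounding
    (M : ℕ → ℕ) (hM : ∀ n : ℕ, |(M n : ℝ) - ((n + 1 : ℕ) : ℝ) ^ (1 + α)| < 1)
    (u₀ : ℝ → ℝ) (hu₀ : ContinuousOn u₀ (Set.Ioo 0 1))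
    (hu₀' : ∀ r ∈ Set.Ioc (0 : ℝ) 1, u₀ r ∈ Set.Icc (0 : ℝ) 1)
    (vl vr : ℝ) (hvl : vl ∈ Set.Icc (0 : ℝ) 1) (hvr : vr ∈ Set.Icc (0 : ℝ) 1)
    -- the process with finite reservoirs
    {Ω : ℕ → Type*} [∀ n, MeasurableSpace (Ω n)]
    (P : ∀ n, Measure (Ω n)) [∀ n, IsProbabilityMeasure (P n)]
    (X : ∀ n, ℝ≥0 → Ω n → State n (M n))
    (hX : ∀ n, IsMarkovProcess (reservoirGenerator n (M n)) (P n) (X n))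
    -- initial condition: reservoir densities converge in probability, channel has profile `u₀`
    (hleft : ∀ δ : ℝ, 0 < δ →
      Tendsto (fun n => P n {ω | δ ≤ |leftDensity (X n 0 ω) - vl|}) atTop (𝓝 0))
    (hright : ∀ δ : ℝ, 0 < δ →
      Tendsto (fun n => P n {ω | δ ≤ |rightDensity (X n 0 ω) - vr|}) atTop (𝓝 0))
    (hX0 : ∀ (n : ℕ) (x : Fin (n + 1)),
      ∫ ω, occ (X n 0 ω).1 x ∂(P n) = u₀ (((x : ℕ) + 1 : ℝ) / ((n + 1 : ℕ) : ℝ)))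
    -- the process with ideal reservoirs, started from the same density profile
    {Ω' : ℕ → Type*} [∀ n, MeasurableSpace (Ω' n)]
    (Q : ∀ n, Measure (Ω' n)) [∀ n, IsProbabilityMeasure (Q n)]
    (Y : ∀ n, ℝ≥0 → Ω' n → Config n)
    (hY : ∀ n, IsMarkovProcess (idealGenerator n vl vr) (Q n) (Y n))
    (hY0 : ∀ (n : ℕ) (x : Fin (n + 1)),
      ∫ ω, occ (Y n 0 ω) x ∂(Q n) = u₀ (((x : ℕ) + 1 : ℝ) / ((n + 1 : ℕ) : ℝ))) :
    ∀ α' : ℝ, 0 ≤ α' → α' < α → ∀ T : ℝ≥0, 0 < T →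
      Tendsto
        (fun n : ℕ => ⨆ x : Fin (n + 1), ⨆ t : Set.Icc (0 : ℝ≥0) T,
          |(∫ ω, occ (X n (((n + 1 : ℕ) : ℝ≥0) ^ (2 + α') * t) ω).1 x ∂(P n))
            - ∫ ω, occ (Y n (((n + 1 : ℕ) : ℝ≥0) ^ (2 + α') * t) ω) x ∂(Q n)|)
        atTop (𝓝 0) := by
  intro α' hα' hαα' T _
  have hMn : ∀ n, 0 < M n ∧ ((n + 1 : ℕ) : ℝ) ^ (1 + α) / 2 ≤ M n := fun n =>
    pos_and_half_le_of_abs_sub_lt_one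
      (Real.one_le_rpow (by push_cast; linarith [Nat.cast_nonneg (α := ℝ) n]) (by linarith)) (hM n)
  have hl := tendsto_abs_integral_sub_of_tendsto_measure P (fun n ω => leftDensity (X n 0 ω))
    (fun n => (measurable_of_finite leftDensity).comp ((hX n).measurable 0))
    (fun n ω => density_mem_Icc _) hvl hleft
  have hr := tendsto_abs_integral_sub_of_tendsto_measure P (fun n ω => rightDensity (X n 0 ω))
    (fun n => (measurable_of_finite rightDensity).comp ((hX n).measurable 0))
    (fun n ω => density_mem_Icc _) hvr hright
  have hN : Tendsto (fun n : ℕ => ((n + 1 : ℕ) : ℝ) ^ (α' - α)) atTop (𝓝 0) := by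
    have h := (tendsto_rpow_neg_atTop (sub_pos.2 hαα')).comp
      (tendsto_natCast_atTop_atTop (R := ℝ) |>.comp (tendsto_add_atTop_nat 1))
    simp only [neg_sub] at h
    exact h
  have hlim := (hl.add hr).add (hN.const_mul (4 + 2 * (T : ℝ)))
  simp only [add_zero, mul_zero] at hlim
  refine squeeze_zero (fun n => Real.iSup_nonneg fun x => Real.iSup_nonneg fun t => abs_nonneg _)
    (fun n => ?_) hlim
  have hb : 0 ≤ |(∫ ω, leftDensity (X n 0 ω) ∂(P n)) - vl|
      + |(∫ ω, rightDensity (X n 0 ω) ∂(P n)) - vr|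
      + (4 + 2 * (T : ℝ)) * ((n + 1 : ℕ) : ℝ) ^ (α' - α) := by positivity
  refine Real.iSup_le (fun x => Real.iSup_le (fun t => ?_) hb) hb
  refine (abs_mean_occ_sub_le (hMn n).1 (hX n) (hY n)
    (fun y => (hX0 n y).trans (hY0 n y).symm) x _).trans ?_
  have h := reservoir_drift_le (T := T) (t := (t : ℝ≥0)) hα'
    (by push_cast; linarith [Nat.cast_nonneg (α := ℝ) n]) (hMn n).2 (NNReal.coe_nonneg _)
    (NNReal.coe_le_coe.2 t.2.2)
  push_cast at h ⊢
  linarith
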